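/- Let $K$ be a compact line, that is, a nonempty linearly ordered set that is compact in its order topology, with least element $0_K$ and greatest element $1_K$. An open interval of $K$ is an order-convex subset of $K$ that is open in $K$. A point $x\in K$ is left-dense if every neighbourhood of $x$ contains a point less than $x$, and left-isolated otherwise (so $0_K$ is left-isolated); right-dense and right-isolated are defined symmetrically. **Integral.** A gauge on $K$ is a map $\delta$ that assigns to each $x\in K$ an open interval $\delta(x)\ni x$. For $a\le b$ in $K$ and $f,G:K\to\mathbb R$, $f$ is $G$-integrable over $[a,b]$ with integral $A=\int_a^b f\,dG$ if for each $\varepsilon>0$ there is a gauge $\delta$ such that $$\Bigl|f(a)G(a)+\sum_{i=1}^n f(t_i)\bigl(G(x_i)-G(x_{i-1})\bigr)-A\Bigr|<\varepsilon$$ whenever $a=x_0\le x_1\le\dots\le x_n=b$, $t_i\in[x_{i-1},x_i]$ and $(x_{i-1},x_i]\subset\delta(t_i)$ for all $i$. "$G$-integrable" means $G$-integrable over $K=[0_K,1_K]$. **Regularity.** A function $g:K\to\mathbb R$ is regulated at $x$ if the left limit of $g$ at $x$ exists in case $x$ is left-dense and the right limit of $g$ at $x$ exists in case $x$ is right-dense.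 It is amenable if it is right-continuous and regulated at every point. If $g$ is regulated at $x$, put $L_g(x)=0$ if $x=0_K$, $L_g(x)=\lim_{y\nearrow x}g(y)$ if $x$ is left-dense, and $L_g(x)=g(x^-)$ if $x\ne 0_K$ is left-isolated with immediate predecessor $x^-$. **Derivative.** Let $G$ be amenable and nondecreasing, $F:K\to\mathbb R$, $x\in K$, $D\in\mathbb R$. If $L_G(x)=G(x)$, then $\frac{dF}{dG}(x)$ exists and equals $D$ if $F(x)=L_F(x)$ in case $x$ is left-isolated, $G$ is not constant on any neighbourhood of $x$, and for every $\varepsilon>0$ there is a neighbourhood $V$ of $x$ with $|F(y)-F(x)-D(G(y)-G(x))|\le\varepsilon|G(y)-G(x)|$ for all $y\in V$. If $L_G(x)\neq G(x)$, then $\frac{dF}{dG}(x)$ exists and equals $D$ if $F$ is regulated at $x$ and for every $\varepsilon>0$ there is a neighbourhood $V$ of $x$ with $|F(y)-L_F(x)-D(G(y)-L_G(x))|\le\varepsilon|G(y)-L_G(x)|$ for all $y\in V$ with $y\ge x$. **Null sets.** For $G$ nondecreasing, nonnegative and amenable, let $\mu_G$ be the Radon measure on $K$ induced by $G$, i.e.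 the unique regular Borel measure with $\int_K\varphi\,d\mu_G=\int_{0_K}^{1_K}\varphi\,dG$ for all continuous $\varphi:K\to\mathbb R$. A set $S\subset K$ is $G$-null if its outer measure $\inf\{\sum_{n}\mu_G(I_n): I_n\subset K \text{ open},\ S\subset\bigcup_{n\in\mathbb N} I_n\}$ is $0$. **Theorem (Fundamental Theorem of Calculus: differentiating integrals).** Let $K$ be a compact line, let $G:K\to\mathbb R$ be nondecreasing, nonnegative and amenable, and let $f:K\to\mathbb R$ be $G$-integrable. Then $f$ is $G$-integrable over $[0_K,x]$ for every $x\in K$, and, with $F(x)=\int_{0_K}^x f\,dG$, there is a $G$-null set $Z\subset K$ such that for every $x\in K\setminus Z$ the derivative $\frac{dF}{dG}(x)$ exists and equals $f(x)$. -/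

import Mathlib

open Set Filter Topology MeasureTheory
open scoped ENNReal

namespace CompactLine

/-! A compact line is a nonempty linear order, compact in its order topology. Its least and greatest
elements are `⊥` and `⊤`. Compact subintervals are handled as `[a, b] ⊆ K`, with `K = [⊥, ⊤]`. -/

/-- An open interval: a convex (order-connected) set that is open in `K`. -/
def IsOpenInterval {K : Type*} [LinearOrder K] [TopologicalSpace K] (I : Set K) : Prop :=
  I.OrdConnected ∧ IsOpen I

/-- A gauge assigns to each point an open interval that contains it. Restricting a gauge to `[a, b]`
gives a gauge on the compact line `[a, b]`, and every gauge on `[a, b]` is refined by one of these. -/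
def IsGauge {K : Type*} [LinearOrder K] [TopologicalSpace K] (δ : K → Set K) : Prop :=
  ∀ x, IsOpenInterval (δ x) ∧ x ∈ δ x

/-- A tagged partition `a = x₀ ≤ x₁ ≤ ⋯ ≤ xₙ = b` of `[a, b]`; the tag `t i` belongs to
`[x i, x (i + 1)]`. Values of `x` beyond `n`, and of `t` from `n` on, play no role. -/
structure TaggedPartition {K : Type*} [LinearOrder K] (a b : K) where
  /-- the number of components -/
  n : ℕ
  /-- the division points -/
  x : ℕ → K
  /-- the tag points -/
  t : ℕ → K
  x_zero : x 0 = a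
  x_last : x n = b
  mono : ∀ i < n, x i ≤ x (i + 1)
  tag_mem : ∀ i < n, t i ∈ Icc (x i) (x (i + 1))

/-- `δ`-fineness constrains the half-open intervals `(x i, x (i + 1)]`. -/
def TaggedPartition.IsFine {K : Type*} [LinearOrder K] {a b : K} (P : TaggedPartition a b)
    (δ : K → Set K) : Prop :=
  ∀ i < P.n, Ioc (P.x i) (P.x (i + 1)) ⊆ δ (P.t i)

/-- The Riemann sum, with its extra term `f a * G a` at the least point of `[a, b]`. -/
def TaggedPartition.riemannSum {K : Type*} [LinearOrder K] {a b : K} (P : TaggedPartition a b)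
    (f G : K → ℝ) : ℝ :=
  f a * G a + ∑ i ∈ Finset.range P.n, f (P.t i) * (G (P.x (i + 1)) - G (P.x i))

/-- `A` is the Kurzweil-Stieltjes integral of `f` with respect to `G` over `[a, b]`. -/
def HasKSIntegral {K : Type*} [LinearOrder K] [TopologicalSpace K] (f G : K → ℝ) (a b : K)
    (A : ℝ) : Prop :=
  ∀ ε > 0, ∃ δ : K → Set K, IsGauge δ ∧
    ∀ P : TaggedPartition a b, P.IsFine δ → |P.riemannSum f G - A| < ε

/-- `f` is `G`-integrable over `[a, b]`. -/
def KSIntegrable {K : Type*} [LinearOrder K] [TopologicalSpace K] (f G : K → ℝ) (a b : K) : Prop :=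
  ∃ A, HasKSIntegral f G a b A

open Classical in
/-- The integral `∫_a^b f dG` (`0` if `f` is not `G`-integrable over `[a, b]`). -/
noncomputable def ksIntegral {K : Type*} [LinearOrder K] [TopologicalSpace K] (f G : K → ℝ)
    (a b : K) : ℝ :=
  if h : KSIntegrable f G a b then h.choose else 0

/-- Left-dense points; the others, `⊥` among them, are left-isolated. -/
def LeftDense {K : Type*} [LinearOrder K] [TopologicalSpace K] (x : K) : Prop :=
  ∀ V ∈ 𝓝 x, ∃ y ∈ V, y < x

/-- Existence of the one-sided limits at `x`. At a left-isolated point `𝓝[<] x` is the bottom filter,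
so that the condition on the left is void there; likewise on the right. -/
def RegulatedAt {K : Type*} [LinearOrder K] [TopologicalSpace K] (G : K → ℝ) (x : K) : Prop :=
  (∃ l, Tendsto G (𝓝[<] x) (𝓝 l)) ∧ (∃ r, Tendsto G (𝓝[>] x) (𝓝 r))

/-- Amenable: right-continuous and regulated. -/
def Amenable {K : Type*} [LinearOrder K] [TopologicalSpace K] (G : K → ℝ) : Prop :=
  (∀ x, ContinuousWithinAt G (Ici x) x) ∧ ∀ x, RegulatedAt G x

open Classical in
/-- `L_G x`: it is `0` at the least point, the value of `G` at the predecessor of `x` if there is one,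
and the left limit of `G` at `x` otherwise (that is, at left-dense points). -/
noncomputable def leftValue {K : Type*} [LinearOrder K] [TopologicalSpace K] [OrderBot K]
    (G : K → ℝ) (x : K) : ℝ :=
  if x = ⊥ then 0
  else if h : ∃ y, y ⋖ x then G h.choose
  else limUnder (𝓝[<] x) G

/-- `F` is `G`-differentiable at `x` with `G`-derivative `D`. -/
def HasGDerivAt {K : Type*} [LinearOrder K] [TopologicalSpace K] [OrderBot K]
    (F G : K → ℝ) (x : K) (D : ℝ) : Prop :=
  (leftValue G x = G x ∧ (¬ LeftDense x → F x = leftValue F x) ∧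
    (∀ V ∈ 𝓝 x, ∃ y ∈ V, ∃ z ∈ V, G y ≠ G z) ∧
    ∀ ε > 0, ∃ V ∈ 𝓝 x, ∀ y ∈ V, |F y - F x - D * (G y - G x)| ≤ ε * |G y - G x|) ∨
  (leftValue G x ≠ G x ∧ RegulatedAt F x ∧
    ∀ ε > 0, ∃ V ∈ 𝓝 x, ∀ y ∈ V ∩ Ici x,
      |F y - leftValue F x - D * (G y - leftValue G x)| ≤ ε * |G y - leftValue G x|)

/-- `μ` is the Radon measure induced by a nondecreasing nonnegative `G`: the (unique) regular Borel
measure on `K` with `∫ φ dμ = ∫_K φ dG` for every continuous `φ`. -/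
def IsInducedMeasure {K : Type*} [LinearOrder K] [TopologicalSpace K] [BoundedOrder K]
    [MeasurableSpace K] (G : K → ℝ) (μ : Measure K) : Prop :=
  μ.Regular ∧ ∀ φ : K → ℝ, Continuous φ → HasKSIntegral φ G ⊥ ⊤ (∫ x, φ x ∂μ)

/-- The outer measure induced by `μ`: the infimum over countable coverings by open sets. -/
noncomputable def outerMeas {K : Type*} [TopologicalSpace K] [MeasurableSpace K] (μ : Measure K)
    (S : Set K) : ℝ≥0∞ :=
  ⨅ (I : ℕ → Set K) (_ : ∀ n, IsOpen (I n)) (_ : S ⊆ ⋃ n, I n), ∑' n, μ (I n)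

/-- `S` is `G`-null: the Radon measure induced by `G` exists and gives `S` outer measure zero. -/
def IsGNull {K : Type*} [LinearOrder K] [TopologicalSpace K] [BoundedOrder K]
    [MeasurableSpace K] (G : K → ℝ) (S : Set K) : Prop :=
  ∃ μ : Measure K, IsInducedMeasure G μ ∧ outerMeas μ S = 0

end CompactLine

/-!
The proof follows the pattern of Lebesgue's differentiation theorem, with the Saks–Henstock lemma in
the place of absolute continuity.

*The integral.* Fine partitions of every interval exist (`IsGauge.exists_isFine`), so that integrals
are unique and the Cauchy criterion gives integrability over `[⊥, x]` (`KSIntegrable.initial`). By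
the Saks–Henstock lemma (`exists_gauge_sum_abs_le`) the errors `F v - F u - f t * (G v - G u)` over
finitely many nonoverlapping fine tagged intervals have a small total. For a single interval this
shows that the jump of `F` at `x` is `f x` times the jump of `G` (`integral_sub_leftValue`), which
settles every point at which `G` jumps, with no exceptions
(`hasGDerivAt_integral_of_leftValue_ne`).

*The measure.* The generalized inverse of `G` maps Lebesgue measure on `(0, G ⊤]` to a Borel measure
on `K` with distribution function `G`. Riemann sums of a continuous function converge to its
integral against this measure. As `K` need not be metrizable, that measure is not known to be
regular; the Riesz–Markov–Kakutani theorem replaces it by a regular one with the same integrals of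
continuous functions, and again with distribution function `G` (`exists_isInducedMeasure`).
Consequently a set of points of continuity of `G` which `G` maps into `[a, b]` has outer measure at
most `b - a` (`measure_le_of_forall_mem_Icc`).

*The exceptional set.* It consists of points of continuity of two kinds. Those near which `G` is
constant lie in a union of open null sets, which is null by regularity
(`measure_setOf_locally_constant`). For the others, where the difference quotients stay away from
`f x`, the bad intervals are mapped by `G` to intervals of the real line. Vitali's covering theorem
in `ℝ` selects disjoint ones whose enlargements cover, and the Saks–Henstock lemma makes their total
length small (`measure_setOf_forall_exists_lt`).
-/

namespace CompactLine

/-! ### Tagged partitions and Cousin's lemma -/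

section Partitions

variable {K : Type*} [LinearOrder K]

/-- The partition of `[a, a]` without components. -/
def TaggedPartition.nil (a : K) : TaggedPartition a a where
  n := 0
  x := fun _ => a
  t := fun _ => a
  x_zero := rfl
  x_last := rfl
  mono := by simp
  tag_mem := by simp

/-- The partition of `[a, b]` with the single tag `t`. -/
def TaggedPartition.single {a b t : K} (ht : t ∈ Icc a b) : TaggedPartition a b where
  n := 1
  x := fun i => if i = 0 then a else b
  t := fun _ => t
  x_zero := rfl
  x_last := rfl
  mono := by
    intro i hi
    obtain rfl : i = 0 := by omega
    simpa using ht.1.trans ht.2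
  tag_mem := by
    intro i hi
    obtain rfl : i = 0 := by omega
    simpa using ht

/-- The concatenation of partitions of `[a, b]` and `[b, c]`. -/
def TaggedPartition.append {a b c : K} (P : TaggedPartition a b) (Q : TaggedPartition b c) :
    TaggedPartition a c where
  n := P.n + Q.n
  x := fun i => if i < P.n then P.x i else Q.x (i - P.n)
  t := fun i => if i < P.n then P.t i else Q.t (i - P.n)
  x_zero := by
    split_ifs with h
    · exact P.x_zero
    · have h0 : P.n = 0 := by omega
      have := P.x_last
      rw [h0, P.x_zero] at this
      simp [Q.x_zero, this]
  x_last := by simp [Q.x_last]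
  mono := by
    intro i hi
    rcases lt_trichotomy (i + 1) P.n with h | h | h
    · simpa [h, (Nat.lt_succ_self i).trans h] using P.mono i (by omega)
    · have := P.mono i (by omega)
      rw [h, P.x_last] at this
      simpa [h, show i < P.n by omega, Q.x_zero] using this
    · have := Q.mono (i - P.n) (by omega)
      rw [show i - P.n + 1 = i + 1 - P.n by omega] at this
      simpa [show ¬ i < P.n by omega, show ¬ i + 1 < P.n by omega] using this
  tag_mem := by
    intro i hi
    rcases lt_trichotomy (i + 1) P.n with h | h | h
    · simpa [h, (Nat.lt_succ_self i).trans h] using P.tag_mem i (by omega)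
    · have := P.tag_mem i (by omega)
      rw [h, P.x_last] at this
      simpa [h, show i < P.n by omega, Q.x_zero] using this
    · have := Q.tag_mem (i - P.n) (by omega)
      rw [show i - P.n + 1 = i + 1 - P.n by omega] at this
      simpa [show ¬ i < P.n by omega, show ¬ i + 1 < P.n by omega] using this

theorem TaggedPartition.append_x_left {a b c : K} (P : TaggedPartition a b)
    (Q : TaggedPartition b c) {i : ℕ} (hi : i ≤ P.n) : (P.append Q).x i = P.x i := by
  rcases hi.lt_or_eq with h | rfl
  · simp [append, h]
  · simp [append, Q.x_zero, P.x_last]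

theorem TaggedPartition.append_x_right {a b c : K} (P : TaggedPartition a b)
    (Q : TaggedPartition b c) (i : ℕ) : (P.append Q).x (P.n + i) = Q.x i := by
  simp [append]

theorem TaggedPartition.append_t_left {a b c : K} (P : TaggedPartition a b)
    (Q : TaggedPartition b c) {i : ℕ} (hi : i < P.n) : (P.append Q).t i = P.t i := by
  simp [append, hi]

theorem TaggedPartition.append_t_right {a b c : K} (P : TaggedPartition a b)
    (Q : TaggedPartition b c) (i : ℕ) : (P.append Q).t (P.n + i) = Q.t i := by
  simp [append]

theorem TaggedPartition.isFine_nil (a : K) (δ : K → Set K) : (nil a).IsFine δ := by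
  simp [IsFine, nil]

theorem TaggedPartition.isFine_single {a b t : K} (ht : t ∈ Icc a b) {δ : K → Set K}
    (h : Ioc a b ⊆ δ t) : (single ht).IsFine δ := by
  intro i hi
  obtain rfl : i = 0 := by simpa [single] using hi
  simpa [single] using h

theorem TaggedPartition.IsFine.append {a b c : K} {P : TaggedPartition a b}
    {Q : TaggedPartition b c} {δ : K → Set K} (hP : P.IsFine δ) (hQ : Q.IsFine δ) :
    (P.append Q).IsFine δ := by
  intro i hi
  by_cases h : i < P.n
  · rw [append_x_left _ _ h.le, append_x_left _ _ h, append_t_left _ _ h]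
    exact hP i h
  · obtain ⟨j, rfl⟩ := Nat.exists_eq_add_of_le (not_lt.1 h)
    rw [add_assoc, append_x_right, append_x_right, append_t_right]
    exact hQ j (Nat.lt_of_add_lt_add_left hi)

theorem TaggedPartition.IsFine.mono {a b : K} {P : TaggedPartition a b} {δ δ' : K → Set K}
    (hP : P.IsFine δ) (h : ∀ x, δ x ⊆ δ' x) : P.IsFine δ' :=
  fun i hi => (hP i hi).trans (h _)

/-- The Riemann sum without the extra term at the least point; this part is additive under
concatenation. -/
def TaggedPartition.incrSum {a b : K} (P : TaggedPartition a b) (f G : K → ℝ) : ℝ :=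
  ∑ i ∈ Finset.range P.n, f (P.t i) * (G (P.x (i + 1)) - G (P.x i))

theorem TaggedPartition.riemannSum_eq {a b : K} (P : TaggedPartition a b) (f G : K → ℝ) :
    P.riemannSum f G = f a * G a + P.incrSum f G := rfl

theorem TaggedPartition.incrSum_single {a b t : K} (ht : t ∈ Icc a b) (f G : K → ℝ) :
    (single ht).incrSum f G = f t * (G b - G a) := by
  simp [incrSum, single]

theorem TaggedPartition.incrSum_append {a b c : K} (P : TaggedPartition a b)
    (Q : TaggedPartition b c) (f G : K → ℝ) :
    (P.append Q).incrSum f G = P.incrSum f G + Q.incrSum f G := by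
  have hn : (P.append Q).n = P.n + Q.n := rfl
  rw [incrSum, hn, Finset.sum_range_add]
  congr 1
  · refine Finset.sum_congr rfl fun i hi => ?_
    have hi := Finset.mem_range.1 hi
    rw [append_x_left _ _ hi.le, append_x_left _ _ hi, append_t_left _ _ hi]
  · refine Finset.sum_congr rfl fun i _ => ?_
    rw [add_assoc, append_x_right, append_x_right, append_t_right]

theorem TaggedPartition.x_mono {a b : K} (P : TaggedPartition a b) {i j : ℕ} (hij : i ≤ j)
    (hj : j ≤ P.n) : P.x i ≤ P.x j := by
  induction j, hij using Nat.le_induction with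
  | base => rfl
  | succ j _ ih => exact (ih (by omega)).trans (P.mono j (by omega))

theorem TaggedPartition.x_mem {a b : K} (P : TaggedPartition a b) {i : ℕ} (hi : i ≤ P.n) :
    P.x i ∈ Icc a b :=
  ⟨P.x_zero.symm.le.trans (P.x_mono (Nat.zero_le i) hi), (P.x_mono hi le_rfl).trans P.x_last.le⟩

end Partitions

section Gauges

variable {K : Type*} [LinearOrder K] [TopologicalSpace K]

theorem IsGauge.inter {δ δ' : K → Set K} (h : IsGauge δ) (h' : IsGauge δ') :
    IsGauge fun x => δ x ∩ δ' x :=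
  fun x => ⟨⟨(h x).1.1.inter (h' x).1.1, (h x).1.2.inter (h' x).1.2⟩, (h x).2, (h' x).2⟩

theorem IsGauge.mem_nhds {δ : K → Set K} (h : IsGauge δ) (x : K) : δ x ∈ 𝓝 x :=
  (h x).1.2.mem_nhds (h x).2

theorem isGauge_univ : IsGauge fun _ : K => univ :=
  fun _ => ⟨⟨ordConnected_univ, isOpen_univ⟩, mem_univ _⟩

theorem KSIntegrable.hasKSIntegral {f G : K → ℝ} {a b : K} (h : KSIntegrable f G a b) :
    HasKSIntegral f G a b (ksIntegral f G a b) := by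
  rw [ksIntegral, dif_pos h]
  exact h.choose_spec

/-- The filter of finer and finer partitions of `[a, b]`. -/
def fineFilter (a b : K) : Filter (TaggedPartition a b) :=
  ⨅ δ ∈ {δ : K → Set K | IsGauge δ}, 𝓟 {P | P.IsFine δ}

theorem hasBasis_fineFilter (a b : K) :
    (fineFilter a b).HasBasis (fun δ => IsGauge δ) fun δ => {P | P.IsFine δ} := by
  refine hasBasis_biInf_principal ?_ ⟨_, isGauge_univ⟩
  intro δ hδ δ' hδ'
  exact ⟨_, hδ.inter hδ', fun P (hP : P.IsFine _) => hP.mono fun _ => inter_subset_left,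
    fun P (hP : P.IsFine _) => hP.mono fun _ => inter_subset_right⟩

theorem hasKSIntegral_iff_tendsto {f G : K → ℝ} {a b : K} {A : ℝ} :
    HasKSIntegral f G a b A ↔
      Tendsto (fun P : TaggedPartition a b => P.riemannSum f G) (fineFilter a b) (𝓝 A) := by
  rw [(hasBasis_fineFilter a b).tendsto_iff Metric.nhds_basis_ball]
  rfl

variable [OrderTopology K] [CompactSpace K]

/-- **Cousin's lemma.** The greatest point `s` of the closure of the set of the `x` such that
`[a, x]` has a fine partition is itself such a point, and it cannot lie below `b`: a partition of `[a, s]`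
could be continued through `δ s`, or by the immediate successor of `s`. -/
theorem IsGauge.exists_isFine {δ : K → Set K} (hδ : IsGauge δ) {a b : K} (hab : a ≤ b) :
    ∃ P : TaggedPartition a b, P.IsFine δ := by
  set S : Set K := {x | x ≤ b ∧ ∃ P : TaggedPartition a x, P.IsFine δ} with hS
  have ext : ∀ y ∈ S, ∀ z, z ≤ b → y ≤ z → ∀ t ∈ Icc y z, Ioc y z ⊆ δ t → z ∈ S := by
    rintro y ⟨-, P, hP⟩ z hz - t ht h
    exact ⟨hz, P.append (.single ht), hP.append (TaggedPartition.isFine_single ht h)⟩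
  have haS : a ∈ S := ⟨hab, .nil a, TaggedPartition.isFine_nil a δ⟩
  obtain ⟨s, hsS, hs⟩ := isClosed_closure.isCompact.exists_isGreatest
    (⟨a, subset_closure haS⟩ : (closure S).Nonempty)
  have hsb : s ≤ b := closure_minimal (fun x hx => hx.1) isClosed_Iic hsS
  have hs' : ∀ y ∈ S, y ≤ s := fun y hy => hs (subset_closure hy)
  have hsmem : s ∈ S := by
    obtain ⟨y, hyδ, hyS⟩ := mem_closure_iff_nhds.1 hsS _ (hδ.mem_nhds s)
    exact ext y hyS s hsb (hs' y hyS) s ⟨hs' y hyS, le_rfl⟩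
      (Ioc_subset_Icc_self.trans ((hδ s).1.1.out hyδ (hδ s).2))
  rcases hsb.lt_or_eq with h | rfl
  · exfalso
    obtain ⟨u, ⟨hsu, hub⟩, hu⟩ := exists_Ico_subset_of_mem_nhds' (hδ.mem_nhds s) h
    by_cases hz : ∃ z, z ∈ Ioo s u
    · obtain ⟨z, hz⟩ := hz
      refine (hs' z ?_).not_gt hz.1
      exact ext s hsmem z (hz.2.le.trans hub) hz.1.le s ⟨le_rfl, hz.1.le⟩
        fun w hw => hu ⟨hw.1.le, hw.2.trans_lt hz.2⟩
    · refine (hs' u ?_).not_gt hsu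
      refine ext s hsmem u hub hsu.le u ⟨hsu.le, le_rfl⟩ fun w hw => ?_
      rcases hw.2.lt_or_eq with h' | rfl
      · exact (hz ⟨w, hw.1, h'⟩).elim
      · exact (hδ w).2
  · exact hsmem.2

end Gauges

/-! ### Integrability on initial intervals and the Saks–Henstock lemma -/

section Integral

variable {K : Type*} [LinearOrder K] [TopologicalSpace K] [OrderTopology K] [CompactSpace K]

theorem HasKSIntegral.unique {f G : K → ℝ} {a b : K} (hab : a ≤ b) {A B : ℝ}
    (hA : HasKSIntegral f G a b A) (hB : HasKSIntegral f G a b B) : A = B := by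
  refine eq_of_abs_sub_le_all fun ε hε => ?_
  obtain ⟨δ, hδ, h⟩ := hA (ε / 2) (half_pos hε)
  obtain ⟨δ', hδ', h'⟩ := hB (ε / 2) (half_pos hε)
  obtain ⟨P, hP⟩ := (hδ.inter hδ').exists_isFine hab
  have h1 := abs_lt.1 (h P (hP.mono fun _ => inter_subset_left))
  have h2 := abs_lt.1 (h' P (hP.mono fun _ => inter_subset_right))
  exact abs_le.2 ⟨by linarith, by linarith⟩

/-- The Cauchy criterion: two fine partitions of `[a, c]` are compared by continuing them with the
same fine partition of `[c, b]`. -/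
theorem KSIntegrable.initial {f G : K → ℝ} {a b c : K} (h : KSIntegrable f G a b) (hac : a ≤ c)
    (hcb : c ≤ b) : KSIntegrable f G a c := by
  obtain ⟨A, hA⟩ := h
  have hne : (fineFilter a c).NeBot :=
    (hasBasis_fineFilter a c).neBot_iff.2 fun hδ => hδ.exists_isFine hac
  have hc : Cauchy (map (fun P : TaggedPartition a c => P.riemannSum f G) (fineFilter a c)) := by
    refine Metric.cauchy_iff.2 ⟨hne.map _, fun ε hε => ?_⟩
    obtain ⟨δ, hδ, h⟩ := hA (ε / 2) (half_pos hε)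
    obtain ⟨R, hR⟩ := hδ.exists_isFine hcb
    refine ⟨_, image_mem_map ((hasBasis_fineFilter a c).mem_of_mem hδ), ?_⟩
    rintro _ ⟨P, hP, rfl⟩ _ ⟨Q, hQ, rfl⟩
    have h1 := abs_lt.1 (h _ (TaggedPartition.IsFine.append hP hR))
    have h2 := abs_lt.1 (h _ (TaggedPartition.IsFine.append hQ hR))
    simp only [TaggedPartition.riemannSum_eq, TaggedPartition.incrSum_append] at h1 h2
    rw [Real.dist_eq]
    simp only [TaggedPartition.riemannSum_eq]
    exact abs_lt.2 ⟨by linarith, by linarith⟩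
  obtain ⟨B, hB⟩ := CompleteSpace.complete hc
  exact ⟨B, hasKSIntegral_iff_tendsto.2 hB⟩

variable [BoundedOrder K]

/-- The increments of the indefinite integral are approximated by the sums of fine partitions. -/
theorem exists_isFine_incrSum {f G F : K → ℝ} (hF : ∀ x, HasKSIntegral f G ⊥ x (F x))
    {δ : K → Set K} (hδ : IsGauge δ) {u v : K} (huv : u ≤ v) {κ : ℝ} (hκ : 0 < κ) :
    ∃ Q : TaggedPartition u v, Q.IsFine δ ∧ |Q.incrSum f G - (F v - F u)| < κ := by
  obtain ⟨δ₁, hδ₁, h₁⟩ := hF u (κ / 2) (half_pos hκ)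
  obtain ⟨δ₂, hδ₂, h₂⟩ := hF v (κ / 2) (half_pos hκ)
  obtain ⟨P, hP⟩ := (hδ₁.inter hδ₂).exists_isFine (bot_le : ⊥ ≤ u)
  obtain ⟨Q, hQ⟩ := (hδ.inter hδ₂).exists_isFine huv
  refine ⟨Q, hQ.mono fun _ => inter_subset_left, ?_⟩
  have e1 := abs_lt.1 (h₁ P (hP.mono fun _ => inter_subset_left))
  have e2 := abs_lt.1 (h₂ _ (TaggedPartition.IsFine.append
    (hP.mono fun _ => inter_subset_right) (hQ.mono fun _ => inter_subset_right)))
  simp only [TaggedPartition.riemannSum_eq, TaggedPartition.incrSum_append] at e1 e2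
  exact abs_lt.2 ⟨by linarith, by linarith⟩

theorem integral_bot_eq {f G F : K → ℝ} (hF : ∀ x, HasKSIntegral f G ⊥ x (F x)) :
    F ⊥ = f ⊥ * G ⊥ := by
  refine (hF ⊥).unique le_rfl fun ε hε => ⟨_, isGauge_univ, fun P _ => ?_⟩
  have hx : ∀ i ≤ P.n, P.x i = ⊥ := fun i hi => le_bot_iff.1 (P.x_mem hi).2
  have : P.incrSum f G = 0 := Finset.sum_eq_zero fun i hi => by
    have hi := Finset.mem_range.1 hi
    rw [hx i hi.le, hx (i + 1) hi, sub_self, mul_zero]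
  simpa [TaggedPartition.riemannSum_eq, this] using hε

theorem integral_eq_of_eq {f G F : K → ℝ} (hG : Monotone G)
    (hF : ∀ x, HasKSIntegral f G ⊥ x (F x)) {u v : K} (huv : u ≤ v) (h : G u = G v) :
    F u = F v := by
  refine eq_of_abs_sub_le_all fun κ hκ => ?_
  obtain ⟨Q, -, hQ⟩ := exists_isFine_incrSum hF isGauge_univ huv hκ
  have hx : ∀ i ≤ Q.n, G (Q.x i) = G u := fun i hi =>
    le_antisymm ((hG (Q.x_mem hi).2).trans h.ge) (hG (Q.x_mem hi).1)
  have : Q.incrSum f G = 0 := Finset.sum_eq_zero fun i hi => by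
    have hi := Finset.mem_range.1 hi
    rw [hx i hi.le, hx (i + 1) hi, sub_self, mul_zero]
  rw [this, zero_sub, neg_sub] at hQ
  exact hQ.le

/-- A finite family of nonoverlapping fine tagged intervals is completed to a fine partition, with
the gaps contributing an arbitrarily small error. The induction removes the last interval. -/
theorem exists_isFine_extending {f G F : K → ℝ} (hF : ∀ x, HasKSIntegral f G ⊥ x (F x))
    {δ : K → Set K} (hδ : IsGauge δ) {ι : Type*} (u v t : ι → K) (s : Finset ι) :
    (∀ i ∈ s, u i < v i ∧ t i ∈ Icc (u i) (v i) ∧ Ioc (u i) (v i) ⊆ δ (t i)) →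
    (∀ i ∈ s, ∀ j ∈ s, i ≠ j → v i ≤ u j ∨ v j ≤ u i) →
    ∀ c, (∀ i ∈ s, v i ≤ c) → ∀ κ > 0, ∃ P : TaggedPartition ⊥ c, P.IsFine δ ∧
      |P.incrSum f G - (F c - F ⊥) -
        ∑ i ∈ s, (f (t i) * (G (v i) - G (u i)) - (F (v i) - F (u i)))| < κ := by
  classical
  induction s using Finset.induction_on_max_value v with
  | empty =>
    intro _ _ c _ κ hκ
    obtain ⟨Q, hQ, h⟩ := exists_isFine_incrSum hF hδ (bot_le : ⊥ ≤ c) hκ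
    exact ⟨Q, hQ, by simpa using h⟩
  | insert j s hj hmax ih =>
    intro h1 h2 c hc κ hκ
    obtain ⟨huv, htj, hfj⟩ := h1 j (Finset.mem_insert_self _ _)
    have hlast : ∀ i ∈ s, v i ≤ u j := by
      intro i hi
      have hne : i ≠ j := fun e => hj (e ▸ hi)
      rcases h2 i (Finset.mem_insert_of_mem hi) j (Finset.mem_insert_self _ _) hne with h | h
      · exact h
      · exact absurd (h.trans_lt (h1 i (Finset.mem_insert_of_mem hi)).1) (hmax i hi).not_gt
    obtain ⟨P, hP, hPe⟩ := ih (fun i hi => h1 i (Finset.mem_insert_of_mem hi))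
      (fun i hi k hk => h2 i (Finset.mem_insert_of_mem hi) k (Finset.mem_insert_of_mem hk))
      (u j) hlast (κ / 2) (half_pos hκ)
    obtain ⟨Q, hQ, hQe⟩ := exists_isFine_incrSum hF hδ (hc j (Finset.mem_insert_self _ _))
      (half_pos hκ)
    refine ⟨(P.append (.single htj)).append Q,
      (hP.append (TaggedPartition.isFine_single htj hfj)).append hQ, ?_⟩
    rw [TaggedPartition.incrSum_append, TaggedPartition.incrSum_append,
      TaggedPartition.incrSum_single, Finset.sum_insert hj]
    have e1 := abs_lt.1 hPe
    have e2 := abs_lt.1 hQe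
    exact abs_lt.2 ⟨by linarith, by linarith⟩

/-- The **Saks–Henstock lemma**. -/
theorem exists_gauge_sum_abs_le {f G F : K → ℝ} (hF : ∀ x, HasKSIntegral f G ⊥ x (F x))
    {η : ℝ} (hη : 0 < η) :
    ∃ δ : K → Set K, IsGauge δ ∧ ∀ (s : Finset K) (u v : K → K),
      (∀ i ∈ s, u i < v i ∧ i ∈ Icc (u i) (v i) ∧ Ioc (u i) (v i) ⊆ δ i) →
      (∀ i ∈ s, ∀ j ∈ s, i ≠ j → v i ≤ u j ∨ v j ≤ u i) →
      ∑ i ∈ s, |F (v i) - F (u i) - f i * (G (v i) - G (u i))| ≤ η := by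
  classical
  obtain ⟨δ, hδ, h⟩ := hF ⊤ (η / 2) (half_pos hη)
  refine ⟨δ, hδ, fun s u v h1 h2 => ?_⟩
  have key : ∀ s' ⊆ s,
      |∑ i ∈ s', (f i * (G (v i) - G (u i)) - (F (v i) - F (u i)))| ≤ η / 2 := by
    intro s' hs'
    refine le_of_forall_pos_le_add fun κ hκ => ?_
    obtain ⟨P, hP, hPe⟩ := exists_isFine_extending hF hδ u v id s' (fun i hi => h1 i (hs' hi))
      (fun i hi j hj => h2 i (hs' hi) j (hs' hj)) ⊤ (fun _ _ => le_top) κ hκ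
    have e1 := abs_lt.1 hPe
    have e2 := abs_lt.1 (h P hP)
    rw [TaggedPartition.riemannSum_eq, ← integral_bot_eq hF] at e2
    simp only [id] at e1
    exact abs_le.2 ⟨by linarith, by linarith⟩
  set e : K → ℝ := fun i => f i * (G (v i) - G (u i)) - (F (v i) - F (u i)) with he
  have e1 := abs_le.1 (key (s.filter fun i => 0 ≤ e i) (Finset.filter_subset _ _))
  have e2 := abs_le.1 (key (s.filter fun i => ¬ 0 ≤ e i) (Finset.filter_subset _ _))
  calc ∑ i ∈ s, |F (v i) - F (u i) - f i * (G (v i) - G (u i))|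
      = ∑ i ∈ s, |e i| := Finset.sum_congr rfl fun i _ => by rw [he, abs_sub_comm]
    _ = ∑ i ∈ s with 0 ≤ e i, e i + ∑ i ∈ s with ¬ 0 ≤ e i, - e i := by
        rw [← Finset.sum_filter_add_sum_filter_not s fun i => 0 ≤ e i]
        congr 1
        · exact Finset.sum_congr rfl fun i hi => abs_of_nonneg (Finset.mem_filter.1 hi).2
        · exact Finset.sum_congr rfl fun i hi =>
            abs_of_neg (not_le.1 (Finset.mem_filter.1 hi).2)
    _ ≤ η := by rw [Finset.sum_neg_distrib]; linarith

/-- The Saks–Henstock lemma for one interval with an end point as its tag. -/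
theorem exists_gauge_abs_le {f G F : K → ℝ} (hF : ∀ x, HasKSIntegral f G ⊥ x (F x))
    {η : ℝ} (hη : 0 < η) :
    ∃ δ : K → Set K, IsGauge δ ∧ ∀ x y, Ioc (min x y) (max x y) ⊆ δ x →
      |F y - F x - f x * (G y - G x)| ≤ η := by
  obtain ⟨δ, hδ, h⟩ := exists_gauge_sum_abs_le hF hη
  refine ⟨δ, hδ, fun x y hxy => ?_⟩
  rcases eq_or_ne x y with rfl | hne
  · simpa using hη.le
  have := h {x} (fun _ => min x y) (fun _ => max x y)
    (by simpa using ⟨hne.symm, hxy⟩) (by simp)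
  rw [Finset.sum_singleton] at this
  rcases le_total x y with hle | hle
  · simpa [hle] using this
  · rw [max_eq_left hle, min_eq_right hle, ← abs_neg] at this
    convert this using 2
    ring

end Integral

/-! ### The measure induced by a nondecreasing right-continuous function -/

section InducedMeasure

/-- A set of reals that contains with each point a half-open interval ending there differs from its
interior by a countable set. -/
theorem measurableSet_of_forall_exists_Ioc_subset {A : Set ℝ}
    (hA : ∀ s ∈ A, ∃ r < s, Ioc r s ⊆ A) : MeasurableSet A := by
  have hc : (A \ interior A).Countable := by
    refine (countable_setOfPred_isolated_left_within (s := A \ interior A)).mono ?_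
    intro s hs
    refine ⟨hs, empty_mem_iff_bot.1 ?_⟩
    obtain ⟨r, hr, h⟩ := hA s hs.1
    have hsub : Ioo r s ⊆ interior A :=
      interior_maximal (Ioo_subset_Ioc_self.trans h) isOpen_Ioo
    filter_upwards [self_mem_nhdsWithin, mem_nhdsWithin_of_mem_nhds (Ioi_mem_nhds hr)] with σ h1 h2
    exact h1.1.2 (hsub ⟨h2, h1.2⟩)
  rw [← sdiff_union_of_subset (interior_subset : interior A ⊆ A)]
  exact hc.measurableSet.union isOpen_interior.measurableSet

variable {K : Type*} [LinearOrder K] [TopologicalSpace K]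

theorem isClosed_setOf_le {G : K → ℝ} (hG : Monotone G)
    (hr : ∀ x, ContinuousWithinAt G (Ici x) x) (a : ℝ) : IsClosed {x | a ≤ G x} := by
  rw [← isOpen_compl_iff, isOpen_iff_mem_nhds]
  intro x hx
  have hx : G x < a := not_le.1 hx
  have h : ∀ᶠ y in 𝓝 x, y ∈ Ici x → G y < a :=
    eventually_nhdsWithin_iff.1 ((hr x).eventually_lt_const hx)
  filter_upwards [h] with y hy
  refine not_le.2 (?_ : G y < a)
  rcases le_total x y with hxy | hxy
  · exact hy hxy
  · exact (hG hxy).trans_lt hx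

variable [OrderTopology K]

theorem isOpenInterval_ordConnectedComponent {U : Set K} (hU : IsOpen U) (x : K) :
    IsOpenInterval (ordConnectedComponent U x) := by
  refine ⟨inferInstance, isOpen_iff_mem_nhds.2 fun y hy => ?_⟩
  rw [ordConnectedComponent_eq hy, ordConnectedComponent_mem_nhds]
  exact hU.mem_nhds (ordConnectedComponent_subset hy)

/-- The generalized inverse is left-continuous, hence Borel measurable, although the topology of `K`
need not have a countable base. -/
theorem measurable_of_le_iff [BoundedOrder K] [MeasurableSpace K]
    [BorelSpace K] {G : K → ℝ} {h : ℝ → K}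
    (hh : ∀ s x, h s ≤ x ↔ min s (G ⊤) ≤ G x) : Measurable h := by
  refine measurable_of_isOpen fun U hU => measurableSet_of_forall_exists_Ioc_subset ?_
  intro s hs
  have mono : ∀ σ ≤ s, h σ ≤ h s := fun σ hσ =>
    (hh _ _).2 ((min_le_min_right _ hσ).trans ((hh s (h s)).1 le_rfl))
  rcases eq_or_ne (h s) ⊥ with hb | hb
  · refine ⟨s - 1, by linarith, fun σ hσ => ?_⟩
    have : h σ = h s := le_antisymm (mono σ hσ.2) (hb ▸ bot_le)
    simpa [this] using hs
  · obtain ⟨y, hy, hyU⟩ := exists_Ioc_subset_of_mem_nhds (hU.mem_nhds hs)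
      ⟨⊥, bot_lt_iff_ne_bot.2 hb⟩
    have h1 : G y < min s (G ⊤) := not_le.1 fun h' => ((hh s y).2 h').not_gt hy
    refine ⟨G y, h1.trans_le (min_le_left _ _), fun σ hσ => hyU ⟨?_, mono σ hσ.2⟩⟩
    refine not_le.1 fun h' => ((hh σ y).1 h').not_gt ?_
    exact lt_min hσ.1 (h1.trans_le (min_le_right _ _))

theorem measure_Ioc_of_measure_Iic [MeasurableSpace K] [BorelSpace K] {G : K → ℝ}
    (h0 : ∀ x, 0 ≤ G x) {ν : Measure K} (hν : ∀ x, ν (Iic x) = ENNReal.ofReal (G x))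
    {x y : K} (hxy : x ≤ y) :
    ν (Ioc x y) = ENNReal.ofReal (G y - G x) := by
  rw [← Iic_sdiff_Iic, measure_sdiff (Iic_subset_Iic.2 hxy) measurableSet_Iic.nullMeasurableSet
    (by simp [hν]), hν, hν, ENNReal.ofReal_sub _ (h0 x)]

variable [CompactSpace K]

theorem exists_isLeast_setOf_le {G : K → ℝ} (hG : Monotone G)
    (hr : ∀ x, ContinuousWithinAt G (Ici x) x) {a : ℝ} (h : ∃ x, a ≤ G x) :
    ∃ m, IsLeast {x | a ≤ G x} m :=
  (isClosed_setOf_le hG hr a).isCompact.exists_isLeast h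

variable [BoundedOrder K]

/-- The generalized inverse of `G`, continued by a constant beyond the range of `G`. -/
theorem exists_generalizedInverse {G : K → ℝ} (hG : Monotone G)
    (hr : ∀ x, ContinuousWithinAt G (Ici x) x) :
    ∃ h : ℝ → K, ∀ s x, h s ≤ x ↔ min s (G ⊤) ≤ G x := by
  choose h hh using fun s : ℝ =>
    exists_isLeast_setOf_le hG hr (a := min s (G ⊤)) ⟨⊤, min_le_right _ _⟩
  exact ⟨h, fun s x => ⟨fun hx => (hh s).1.trans (hG hx), fun hx => (hh s).2 hx⟩⟩

variable [MeasurableSpace K] [BorelSpace K]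

/-- There is a finite Borel measure whose distribution function is `G`: the image of Lebesgue
measure on `(0, G ⊤]` under the generalized inverse. Its regularity is not claimed. -/
theorem exists_measure_Iic {G : K → ℝ} (hG : Monotone G)
    (hr : ∀ x, ContinuousWithinAt G (Ici x) x) :
    ∃ ν : Measure K, IsFiniteMeasure ν ∧ ∀ x, ν (Iic x) = ENNReal.ofReal (G x) := by
  obtain ⟨h, hh⟩ := exists_generalizedInverse hG hr
  have hm := measurable_of_le_iff hh
  refine ⟨(volume.restrict (Ioc 0 (G ⊤))).map h, inferInstance, fun x => ?_⟩
  rw [Measure.map_apply hm measurableSet_Iic, Measure.restrict_apply (hm measurableSet_Iic)]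
  have : h ⁻¹' Iic x ∩ Ioc 0 (G ⊤) = Ioc 0 (G x) := by
    ext s
    simp only [mem_inter_iff, mem_preimage, mem_Iic, mem_Ioc, hh]
    constructor
    · rintro ⟨h1, h2, h3⟩
      exact ⟨h2, by rwa [min_eq_left h3] at h1⟩
    · rintro ⟨h2, h1⟩
      exact ⟨(min_le_left _ _).trans h1, h2, h1.trans (hG le_top)⟩
  rw [this, Real.volume_Ioc, sub_zero]

/-- On a partition fine for a gauge on whose members `φ` oscillates little, the Riemann sum is the
integral of a step function uniformly close to `φ`. -/
theorem hasKSIntegral_of_continuous {G : K → ℝ} (hG : Monotone G) (h0 : ∀ x, 0 ≤ G x)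
    {ν : Measure K} [IsFiniteMeasure ν] (hν : ∀ x, ν (Iic x) = ENNReal.ofReal (G x))
    {φ : K → ℝ} (hφ : Continuous φ) : HasKSIntegral φ G ⊥ ⊤ (∫ x, φ x ∂ν) := by
  intro ε hε
  have hpos : 0 < G ⊤ + 1 := by linarith [h0 ⊤]
  set κ := ε / (G ⊤ + 1) with hκ
  have hκ0 : 0 < κ := div_pos hε hpos
  have hint : Integrable φ ν := by
    exact hφ.integrable_of_hasCompactSupport (HasCompactSupport.of_compactSpace φ)
  have hδ : ∀ x, ∃ V, IsOpenInterval V ∧ x ∈ V ∧ ∀ y ∈ V, |φ x - φ y| ≤ κ := by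
    intro x
    have hU : IsOpen {y | |φ x - φ y| < κ} :=
      isOpen_lt (continuous_const.sub hφ).abs continuous_const
    refine ⟨_, isOpenInterval_ordConnectedComponent hU x, by simpa using hκ0,
      fun y hy => ?_⟩
    have : y ∈ {y | |φ x - φ y| < κ} := ordConnectedComponent_subset hy
    exact le_of_lt this
  choose δ hδ1 hδ2 hδ3 using hδ
  refine ⟨δ, fun x => ⟨hδ1 x, hδ2 x⟩, fun P hP => ?_⟩
  have hbot : ∫ x in Iic ⊥, φ x ∂ν = φ ⊥ * G ⊥ := by
    rw [Iic_bot, integral_singleton, measureReal_def, ← Iic_bot, hν,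
      ENNReal.toReal_ofReal (h0 _), smul_eq_mul, mul_comm]
  -- Additivity of the integral along the partition.
  have hsplit : ∀ k ≤ P.n, ∫ x in Iic (P.x k), φ x ∂ν = φ ⊥ * G ⊥ +
      ∑ i ∈ Finset.range k, ∫ x in Ioc (P.x i) (P.x (i + 1)), φ x ∂ν := by
    intro k
    induction k with
    | zero => intro _; rw [P.x_zero, hbot]; simp
    | succ k ih =>
      intro hk
      rw [Finset.sum_range_succ, ← add_assoc, ← ih (by omega),
        ← Iic_union_Ioc_eq_Iic (P.mono k (by omega)),
        setIntegral_union (Iic_disjoint_Ioc le_rfl)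
          measurableSet_Ioc hint.integrableOn hint.integrableOn]
  have hpiece : ∀ i ∈ Finset.range P.n,
      |φ (P.t i) * (G (P.x (i + 1)) - G (P.x i)) - ∫ x in Ioc (P.x i) (P.x (i + 1)), φ x ∂ν|
        ≤ κ * (G (P.x (i + 1)) - G (P.x i)) := by
    intro i hi
    have hi := Finset.mem_range.1 hi
    have hm : ν.real (Ioc (P.x i) (P.x (i + 1))) = G (P.x (i + 1)) - G (P.x i) := by
      rw [measureReal_def, measure_Ioc_of_measure_Iic h0 hν (P.mono i hi),
        ENNReal.toReal_ofReal (sub_nonneg.2 (hG (P.mono i hi)))]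
    have : φ (P.t i) * (G (P.x (i + 1)) - G (P.x i)) - ∫ x in Ioc (P.x i) (P.x (i + 1)), φ x ∂ν
        = ∫ x in Ioc (P.x i) (P.x (i + 1)), (φ (P.t i) - φ x) ∂ν := by
      rw [integral_sub (integrable_const _) hint.integrableOn, setIntegral_const, hm, smul_eq_mul,
        mul_comm]
    rw [this, ← hm, ← Real.norm_eq_abs]
    exact norm_setIntegral_le_of_norm_le_const (measure_lt_top _ _)
      fun x hx => hδ3 _ _ (hP i hi hx)
  have htop := hsplit P.n le_rfl
  rw [P.x_last, Iic_top, Measure.restrict_univ] at htop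
  calc |P.riemannSum φ G - ∫ x, φ x ∂ν|
      = |∑ i ∈ Finset.range P.n, (φ (P.t i) * (G (P.x (i + 1)) - G (P.x i)) -
          ∫ x in Ioc (P.x i) (P.x (i + 1)), φ x ∂ν)| := by
        rw [htop, Finset.sum_sub_distrib, TaggedPartition.riemannSum]
        congr 1
        ring
    _ ≤ ∑ i ∈ Finset.range P.n, κ * (G (P.x (i + 1)) - G (P.x i)) :=
        (Finset.abs_sum_le_sum_abs _ _).trans (Finset.sum_le_sum hpiece)
    _ = κ * (G ⊤ - G ⊥) := by
        rw [← Finset.mul_sum, Finset.sum_range_sub (fun i => G (P.x i)), P.x_last, P.x_zero]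
    _ < κ * (G ⊤ + 1) := by
        apply mul_lt_mul_of_pos_left _ hκ0
        linarith [h0 ⊥]
    _ = ε := div_mul_cancel₀ _ hpos.ne'

/-- The induced measure exists, and `G` is its distribution function. It is the regular measure that
represents, by the Riesz–Markov–Kakutani theorem, integration against the image measure of
`exists_measure_Iic`. -/
theorem exists_isInducedMeasure {G : K → ℝ} (hG : Monotone G) (h0 : ∀ x, 0 ≤ G x)
    (hr : ∀ x, ContinuousWithinAt G (Ici x) x) :
    ∃ μ : Measure K, IsInducedMeasure G μ ∧ ∀ x, μ (Iic x) = ENNReal.ofReal (G x) := by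
  obtain ⟨ν, hfin, hν⟩ := exists_measure_Iic hG hr
  set μ : Measure K :=
    RealRMK.rieszMeasure (CompactlySupportedContinuousMap.integralPositiveLinearMap ν)
  have hreg : μ.Regular := RealRMK.regular_rieszMeasure _
  have hint : ∀ φ : K → ℝ, Continuous φ → ∫ x, φ x ∂μ = ∫ x, φ x ∂ν := fun φ hφ =>
    RealRMK.integral_rieszMeasure (CompactlySupportedContinuousMap.integralPositiveLinearMap ν)
      (CompactlySupportedContinuousMap.continuousMapEquiv ⟨φ, hφ⟩)
  refine ⟨μ, ⟨hreg, fun φ hφ => ?_⟩, ?_⟩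
  · rw [hint φ hφ]
    exact hasKSIntegral_of_continuous hG h0 hν hφ
  have hcomp : ∀ C, IsCompact C → ν C ≤ μ C := fun C hC =>
    RealRMK.measure_le_of_isCompact_of_integral (fun φ => (hint φ φ.continuous).ge) hC
  have huniv : μ univ = ν univ := by
    have := hint (fun _ => 1) continuous_const
    rw [integral_const, integral_const, smul_eq_mul, smul_eq_mul, mul_one, mul_one,
      measureReal_def, measureReal_def] at this
    exact (ENNReal.toReal_eq_toReal_iff' (measure_ne_top _ _) (measure_ne_top _ _)).1 this
  intro x
  refine le_antisymm ?_ (hν x ▸ hcomp _ isClosed_Iic.isCompact)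
  -- The upper bound follows from the bounds on the compact subsets `Ici z` of the complement.
  have hIci : ∀ z, x < z → μ (Iic x) ≤ ν (Iio z) := by
    intro z hz
    have h1 : μ (Iic x) ≤ μ (Iio z) := measure_mono fun y hy => lt_of_le_of_lt hy hz
    refine h1.trans ?_
    rw [← compl_Ici, measure_compl measurableSet_Ici (measure_ne_top _ _),
      measure_compl measurableSet_Ici (measure_ne_top _ _), huniv]
    exact tsub_le_tsub_left (hcomp _ isClosed_Ici.isCompact) _
  rcases (𝓝[>] x).eq_or_neBot with hb | hne
  · rcases nhdsGT_eq_bot_iff.1 hb with ht | ⟨b, hxb⟩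
    · have : Iic x = univ := eq_univ_of_forall ht
      rw [← hν x, this, huniv]
    · rw [← hν x, ← hxb.Iio_eq]
      exact hxb.Iio_eq ▸ hIci b hxb.lt
  · have h1 : Tendsto (fun z => ENNReal.ofReal (G z)) (𝓝[>] x) (𝓝 (ENNReal.ofReal (G x))) :=
      (ENNReal.continuous_ofReal.tendsto _).comp ((hr x).mono Ioi_subset_Ici_self)
    refine ge_of_tendsto h1 ?_
    filter_upwards [self_mem_nhdsWithin] with z hz
    exact (hIci z hz).trans (hν z ▸ measure_mono Iio_subset_Iic_self)

end InducedMeasure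

/-! ### Left values -/

section LeftValue

variable {K : Type*} [LinearOrder K] [TopologicalSpace K]

theorem leftValue_bot [OrderBot K] (g : K → ℝ) : leftValue g ⊥ = 0 := by
  simp [leftValue]

theorem leftValue_of_covBy [OrderBot K] (g : K → ℝ) {p x : K} (h : p ⋖ x) :
    leftValue g x = g p := by
  have hex : ∃ y, y ⋖ x := ⟨p, h⟩
  rw [leftValue, if_neg h.lt.ne_bot, dif_pos hex, hex.choose_spec.unique_left h]

variable [OrderTopology K]

theorem leftValue_of_tendsto [OrderBot K] {g : K → ℝ} {x : K} [hx : (𝓝[<] x).NeBot] {l : ℝ}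
    (h : Tendsto g (𝓝[<] x) (𝓝 l)) : leftValue g x = l := by
  have h1 : ¬ (IsBot x ∨ ∃ y, y ⋖ x) := fun h' => hx.ne (nhdsLT_eq_bot_iff.2 h')
  have h2 : x ≠ ⊥ := fun e => h1 (.inl (e ▸ isBot_bot))
  rw [leftValue, if_neg h2, dif_neg fun h' => h1 (.inr h')]
  exact h.limUnder_eq

theorem eq_bot_or_covBy_or_neBot [OrderBot K] (x : K) :
    x = ⊥ ∨ (∃ p, p ⋖ x) ∨ (𝓝[<] x).NeBot := by
  rcases (𝓝[<] x).eq_or_neBot with h | h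
  · rcases nhdsLT_eq_bot_iff.1 h with h | h
    · exact .inl (isBot_iff_eq_bot.1 h)
    · exact .inr (.inl h)
  · exact .inr (.inr h)

theorem leftValue_le [OrderBot K] {G : K → ℝ} (hG : Monotone G) (h0 : ∀ x, 0 ≤ G x)
    {x : K} (hr : RegulatedAt G x) : leftValue G x ≤ G x := by
  obtain ⟨l, hl⟩ := hr.1
  rcases eq_bot_or_covBy_or_neBot x with rfl | ⟨p, hp⟩ | h
  · exact leftValue_bot G ▸ h0 _
  · exact leftValue_of_covBy G hp ▸ hG hp.le
  · rw [leftValue_of_tendsto hl]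
    refine le_of_tendsto hl ?_
    filter_upwards [self_mem_nhdsWithin] with y hy
    exact hG (le_of_lt hy)

variable [CompactSpace K] [BoundedOrder K]

theorem tendsto_integral_sub {f G F : K → ℝ} (hF : ∀ x, HasKSIntegral f G ⊥ x (F x)) (x : K) :
    Tendsto (fun y => F y - F x - f x * (G y - G x)) (𝓝 x) (𝓝 0) := by
  rw [Metric.tendsto_nhds]
  intro ε hε
  obtain ⟨δ, hδ, h⟩ := exists_gauge_abs_le hF (half_pos hε)
  filter_upwards [hδ.mem_nhds x] with y hy
  rw [Real.dist_eq, sub_zero]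
  refine (h x y ?_).trans_lt (half_lt_self hε)
  exact Ioc_subset_Icc_self.trans ((hδ x).1.1.uIcc_subset (hδ x).2 hy)

theorem regulatedAt_integral {f G F : K → ℝ} (hF : ∀ x, HasKSIntegral f G ⊥ x (F x)) {x : K}
    (hr : RegulatedAt G x) : RegulatedAt F x := by
  have key : ∀ s : Set K, (∃ l, Tendsto G (𝓝[s] x) (𝓝 l)) → ∃ l, Tendsto F (𝓝[s] x) (𝓝 l) := by
    rintro s ⟨l, hl⟩
    have h1 := (((tendsto_integral_sub hF x).mono_left nhdsWithin_le_nhds).add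
      ((hl.sub_const (G x)).const_mul (f x))).add_const (F x)
    exact ⟨_, h1.congr fun y => by ring⟩
  exact ⟨key _ hr.1, key _ hr.2⟩

/-- The jump of the indefinite integral at `x` is `f x` times the jump of `G`. -/
theorem integral_sub_leftValue {f G F : K → ℝ} (hF : ∀ x, HasKSIntegral f G ⊥ x (F x)) {x : K}
    (hr : RegulatedAt G x) : F x - leftValue F x = f x * (G x - leftValue G x) := by
  rcases eq_bot_or_covBy_or_neBot x with rfl | ⟨p, hp⟩ | h
  · rw [leftValue_bot, leftValue_bot, integral_bot_eq hF, sub_zero, sub_zero]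
  · rw [leftValue_of_covBy F hp, leftValue_of_covBy G hp]
    refine eq_of_abs_sub_le_all fun η hη => ?_
    obtain ⟨δ, hδ, h⟩ := exists_gauge_abs_le hF hη
    have := h x p fun y hy => by
      rw [min_eq_right hp.le, max_eq_left hp.le] at hy
      rw [(hp.Ioc_eq ▸ hy : y ∈ ({x} : Set K))]
      exact (hδ x).2
    rw [← abs_neg] at this
    rwa [show F x - F p - f x * (G x - G p) = -(F p - F x - f x * (G p - G x)) by ring]
  · obtain ⟨l, hl⟩ := hr.1
    have h1 := (((tendsto_integral_sub hF x).mono_left nhdsWithin_le_nhds).add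
      ((hl.sub_const (G x)).const_mul (f x))).add_const (F x)
    have h2 : Tendsto F (𝓝[<] x) (𝓝 (0 + f x * (l - G x) + F x)) := h1.congr fun y => by ring
    rw [leftValue_of_tendsto h2, leftValue_of_tendsto hl]
    ring

end LeftValue

/-! ### Null sets -/

section Null

variable {K : Type*} [TopologicalSpace K] [MeasurableSpace K]

theorem outerMeas_eq_zero {μ : Measure K} [μ.OuterRegular] {S : Set K} (h : μ S = 0) :
    outerMeas μ S = 0 := by
  refine le_antisymm (le_of_forall_gt fun ε hε => ?_) bot_le
  obtain ⟨U, hSU, hU, hμU⟩ := S.exists_isOpen_lt_of_lt (μ := μ) ε (h ▸ hε)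
  refine lt_of_le_of_lt ?_ hμU
  refine iInf_le_of_le (fun n => if n = 0 then U else ∅) (iInf_le_of_le ?_ (iInf_le_of_le ?_ ?_))
  · intro n
    dsimp only
    split_ifs
    · exact hU
    · exact isOpen_empty
  · exact hSU.trans (subset_iUnion_of_subset 0 (by simp))
  · rw [tsum_eq_single 0 fun n hn => by simp [hn]]
    simp

variable [LinearOrder K] [OrderTopology K] [BorelSpace K]

theorem measure_singleton_eq_zero [OrderBot K] {G : K → ℝ} (h0 : ∀ x, 0 ≤ G x)
    {μ : Measure K} (hμ : ∀ x, μ (Iic x) = ENNReal.ofReal (G x)) {x : K}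
    (hr : RegulatedAt G x) (hx : leftValue G x = G x) : μ {x} = 0 := by
  obtain ⟨l, hl⟩ := hr.1
  rcases eq_bot_or_covBy_or_neBot x with rfl | ⟨p, hp⟩ | h
  · rw [← Iic_bot, hμ, ← hx, leftValue_bot, ENNReal.ofReal_zero]
  · rw [← hp.Ioc_eq, measure_Ioc_of_measure_Iic h0 hμ hp.le, ← hx, leftValue_of_covBy G hp,
      sub_self, ENNReal.ofReal_zero]
  · have h1 := (ENNReal.continuous_ofReal.tendsto _).comp (hl.const_sub (G x))
    rw [← hx, leftValue_of_tendsto hl, sub_self, ENNReal.ofReal_zero] at h1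
    refine le_antisymm (ge_of_tendsto h1 ?_) bot_le
    filter_upwards [self_mem_nhdsWithin] with y hy
    have hy : y < x := hy
    have hxl : l = G x := leftValue_of_tendsto hl ▸ hx
    rw [Function.comp_apply, hxl, ← measure_Ioc_of_measure_Iic h0 hμ hy.le]
    exact measure_mono (singleton_subset_iff.2 ⟨hy, le_rfl⟩)

variable [CompactSpace K]

/-- When `m` is the least point with `a ≤ G m`, the points of `{G ≤ b}` beyond `m` have measure at
most `b - a`: a compact subset lies in some `Ioc m q` with `G q ≤ b`. -/
theorem measure_setOf_le_sdiff_Iic_le {G : K → ℝ} (hG : Monotone G) (h0 : ∀ x, 0 ≤ G x)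
    {μ : Measure K} [μ.Regular] (hμ : ∀ x, μ (Iic x) = ENNReal.ofReal (G x)) {a b : ℝ} {m : K}
    (hm : a ≤ G m) : μ ({x | G x ≤ b} \ Iic m) ≤ ENNReal.ofReal (b - a) := by
  have hord : ({x | G x ≤ b} \ Iic m).OrdConnected :=
    ⟨fun x hx y hy z hz => ⟨(hG hz.2).trans hy.1, fun h => hx.2 (hz.1.trans h)⟩⟩
  rw [hord.measurableSet.measure_eq_iSup_isCompact_of_ne_top (measure_ne_top _ _)]
  refine iSup_le fun C => iSup_le fun hCs => iSup_le fun hC => ?_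
  rcases C.eq_empty_or_nonempty with rfl | hne
  · simp
  obtain ⟨q, hqC, hq⟩ := hC.exists_isGreatest hne
  have hsub : C ⊆ Ioc m q := fun x hx => ⟨not_le.1 (hCs hx).2, hq hx⟩
  have hGq : G q ≤ b := (hCs hqC).1
  refine (measure_mono hsub).trans ?_
  rw [measure_Ioc_of_measure_Iic h0 hμ (hsub hqC).1.le]
  exact ENNReal.ofReal_le_ofReal (by linarith)

variable [BoundedOrder K]

/-- `G⁻¹' [a, b]` has a least point, which may be an atom. All its other points have total mass at
most `b - a`, so that the bound holds for sets without atoms. No measurability of `S` is needed. -/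
theorem measure_le_of_forall_mem_Icc {G : K → ℝ} (hG : Monotone G) (h0 : ∀ x, 0 ≤ G x)
    (hGa : Amenable G) {μ : Measure K} [μ.Regular]
    (hμ : ∀ x, μ (Iic x) = ENNReal.ofReal (G x)) {S : Set K}
    (hS : ∀ x ∈ S, leftValue G x = G x) {a b : ℝ} (hab : ∀ x ∈ S, G x ∈ Icc a b) :
    μ S ≤ ENNReal.ofReal (b - a) := by
  rcases S.eq_empty_or_nonempty with rfl | ⟨s, hs⟩
  · simp
  obtain ⟨m, hm, hmin⟩ := exists_isLeast_setOf_le hG hGa.1 ⟨s, (hab s hs).1⟩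
  have hsub : S ⊆ (S ∩ {m}) ∪ ({x | G x ≤ b} \ Iic m) := by
    intro x hx
    rcases (hmin (hab x hx).1).eq_or_lt with rfl | h
    · exact .inl ⟨hx, rfl⟩
    · exact .inr ⟨(hab x hx).2, not_le.2 h⟩
  have hnull : μ (S ∩ {m}) = 0 := by
    by_cases hmS : m ∈ S
    · exact measure_mono_null inter_subset_right
        (measure_singleton_eq_zero h0 hμ (hGa.2 m) (hS m hmS))
    · rw [inter_singleton_eq_empty.2 hmS, measure_empty]
  calc μ S ≤ μ (S ∩ {m}) + μ ({x | G x ≤ b} \ Iic m) :=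
        (measure_mono hsub).trans (measure_union_le _ _)
    _ ≤ ENNReal.ofReal (b - a) := by
        rw [hnull, zero_add]
        exact measure_setOf_le_sdiff_Iic_le hG h0 hμ hm

/-- The points of continuity near which `G` is constant form a null set. They have open null
neighbourhoods, and an arbitrary union of open null sets is null for a regular measure. -/
theorem measure_setOf_locally_constant {G : K → ℝ} (hG : Monotone G) (h0 : ∀ x, 0 ≤ G x)
    (hGa : Amenable G) {μ : Measure K} [μ.Regular]
    (hμ : ∀ x, μ (Iic x) = ENNReal.ofReal (G x)) :
    μ {x | leftValue G x = G x ∧ ∃ V ∈ 𝓝 x, ∀ y ∈ V, ∀ z ∈ V, G y = G z} = 0 := by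
  set O : Set K := ⋃₀ {W | IsOpen W ∧ μ W = 0}
  have hO : μ O = 0 := by
    have hopen : IsOpen O := isOpen_sUnion fun W hW => hW.1
    rw [hopen.measure_eq_iSup_isCompact]
    simp only [ENNReal.iSup_eq_zero]
    intro C hCO hC
    refine hC.measure_zero_of_nhdsWithin fun x hx => ?_
    obtain ⟨W, hW, hxW⟩ := hCO hx
    exact ⟨W, mem_nhdsWithin_of_mem_nhds (hW.1.mem_nhds hxW), hW.2⟩
  refine measure_mono_null ?_ hO
  rintro x ⟨hx, V, hV, hc⟩
  have hVx : ∀ y ∈ V, G y = G x := fun y hy => hc y hy x (mem_of_mem_nhds hV)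
  obtain ⟨m, hm, hmin⟩ := exists_isLeast_setOf_le hG hGa.1 ⟨x, le_refl (G x)⟩
  have hnull : μ ({y | G y ≤ G x} \ Iic m) = 0 := by
    simpa using measure_setOf_le_sdiff_Iic_le (b := G x) hG h0 hμ hm
  rcases (hmin (le_refl (G x) : x ∈ {y | G x ≤ G y})).eq_or_lt with rfl | hmx
  · refine ⟨interior V, ⟨isOpen_interior, ?_⟩, mem_interior_iff_mem_nhds.2 hV⟩
    refine measure_mono_null (t := {m} ∪ ({y | G y ≤ G m} \ Iic m)) (fun y hy => ?_)
      (measure_union_null (measure_singleton_eq_zero h0 hμ (hGa.2 m) hx) hnull)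
    have hy := hVx y (interior_subset hy)
    rcases (hmin hy.ge).eq_or_lt with rfl | h
    · exact .inl rfl
    · exact .inr ⟨hy.le, not_le.2 h⟩
  -- Here `m` may carry positive mass, so that it has to be removed from the neighbourhood.
  · refine ⟨interior V ∩ Ioi m, ⟨isOpen_interior.inter isOpen_Ioi, ?_⟩,
      mem_interior_iff_mem_nhds.2 hV, hmx⟩
    refine measure_mono_null (fun y hy => ?_) hnull
    exact ⟨(hVx y (interior_subset hy.1)).le, not_le.2 hy.2⟩

/-- The covering argument. Each point `x` of the set comes with an interval with end point `x` on
which the increment of `F` deviates from `f x` times that of `G`, and which is fine for a gauge from the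
Saks–Henstock lemma. Vitali's covering theorem, applied to the `G`-images of these intervals in `ℝ`,
selects nonoverlapping ones whose enlargements cover; their total `G`-length is controlled by the
Saks–Henstock lemma. -/
theorem measure_setOf_forall_exists_lt {f G F : K → ℝ} (hG : Monotone G) (h0 : ∀ x, 0 ≤ G x)
    (hGa : Amenable G) (hF : ∀ x, HasKSIntegral f G ⊥ x (F x)) {μ : Measure K} [μ.Regular]
    (hμ : ∀ x, μ (Iic x) = ENNReal.ofReal (G x)) {ε : ℝ} (hε : 0 < ε) :
    μ {x | leftValue G x = G x ∧
      ∀ V ∈ 𝓝 x, ∃ y ∈ V, ε * |G y - G x| < |F y - F x - f x * (G y - G x)|} = 0 := by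
  set S := {x | leftValue G x = G x ∧
      ∀ V ∈ 𝓝 x, ∃ y ∈ V, ε * |G y - G x| < |F y - F x - f x * (G y - G x)|} with hS
  refine le_antisymm (ENNReal.le_of_forall_pos_le_add fun κ hκ _ => ?_) bot_le
  rw [zero_add]
  have hη : 0 < κ * ε / 5 := by positivity
  obtain ⟨δ, hδ, hSH⟩ := exists_gauge_sum_abs_le hF hη
  have hex : ∀ x, ∃ y, x ∈ S →
      y ∈ δ x ∧ ε * |G y - G x| < |F y - F x - f x * (G y - G x)| := by
    intro x
    by_cases hx : x ∈ S
    · obtain ⟨y, hy⟩ := hx.2 _ (hδ.mem_nhds x)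
      exact ⟨y, fun _ => hy⟩
    · exact ⟨x, fun h => absurd h hx⟩
  choose y hy using hex
  have hne : ∀ x ∈ S, G (y x) ≠ G x := by
    intro x hx he
    have hFe : F (y x) = F x := by
      rcases le_total x (y x) with h | h
      · exact (integral_eq_of_eq hG hF h he.symm).symm
      · exact integral_eq_of_eq hG hF h he
    have := (hy x hx).2
    simp [he, hFe] at this
  -- The closed balls below are the intervals in `ℝ` with end points `G x` and `G (y x)`.
  set c : K → ℝ := fun x => (G x + G (y x)) / 2 with hc
  set r : K → ℝ := fun x => |G (y x) - G x| / 2 with hr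
  have hrpos : ∀ x ∈ S, 0 < r x := fun x hx => half_pos (abs_pos.2 (sub_ne_zero.2 (hne x hx)))
  have hball : ∀ x, Metric.closedBall (c x) (r x) = uIcc (G x) (G (y x)) := by
    intro x
    rw [Real.closedBall_eq_Icc, uIcc]
    simp only [hc, hr]
    rcases le_total (G x) (G (y x)) with h | h
    · rw [abs_of_nonneg (sub_nonneg.2 h), min_eq_left h, max_eq_right h]
      congr 1 <;> ring
    · rw [abs_of_nonpos (sub_nonpos.2 h), min_eq_right h, max_eq_left h]
      congr 1 <;> ring
  have hrle : ∀ x ∈ S, r x ≤ G ⊤ := by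
    intro x _
    have h1 := hG (le_top : x ≤ ⊤)
    have h2 := hG (le_top : y x ≤ ⊤)
    have h3 : |G (y x) - G x| ≤ G ⊤ := abs_le.2 ⟨by linarith [h0 (y x)], by linarith [h0 x]⟩
    have h4 := abs_nonneg (G (y x) - G x)
    simp only [hr]
    linarith
  obtain ⟨u, huS, hdisj, hcov⟩ := Vitali.exists_disjoint_subfamily_covering_enlargement_closedBall
    S c r (G ⊤) hrle 5 (by norm_num)
  have hcount : u.Countable := hdisj.countable_of_nonempty_interior fun x hx => by
    refine ⟨c x, interior_mono Metric.ball_subset_closedBall ?_⟩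
    rw [Metric.isOpen_ball.interior_eq]
    exact Metric.mem_ball_self (hrpos x (huS hx))
  -- The Saks–Henstock lemma bounds the total length of finitely many selected intervals.
  have hfin : ∀ s : Finset K, (s : Set K) ⊆ u → ∑ x ∈ s, 10 * r x ≤ κ := by
    intro s hs
    have h1 := hSH s (fun x => min x (y x)) (fun x => max x (y x)) (fun x hx => by
      have hxS := huS (hs hx)
      refine ⟨min_lt_max.2 fun e => hne x hxS (congrArg G e.symm),
        ⟨min_le_left _ _, le_max_left _ _⟩, ?_⟩
      exact Ioc_subset_Icc_self.trans ((hδ x).1.1.uIcc_subset (hδ x).2 (hy x hxS).1))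
      (fun i hi j hj hij => by
        have hd := hdisj (hs hi) (hs hj) hij
        simp only [Function.onFun, hball] at hd
        -- Overlapping intervals of `K` would give their images the common point below.
        by_contra! hcon
        refine Set.not_disjoint_iff.2
          ⟨max (G (min i (y i))) (G (min j (y j))), ?_, ?_⟩ hd
        · rw [uIcc, ← hG.map_min, ← hG.map_max]
          exact ⟨le_max_left _ _, max_le (hG min_le_max) (hG hcon.1.le)⟩
        · rw [uIcc, ← hG.map_min, ← hG.map_max]
          exact ⟨le_max_right _ _, max_le (hG hcon.2.le) (hG min_le_max)⟩)
    have h2 : ∑ x ∈ s, ε * (2 * r x) ≤ κ * ε / 5 := by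
      refine (Finset.sum_le_sum fun x hx => ?_).trans h1
      have h3 := (hy x (huS (hs hx))).2
      have h4 : ε * (2 * r x) = ε * |G (y x) - G x| := by simp only [hr]; ring
      rw [h4]
      refine h3.le.trans (le_of_eq ?_)
      rcases le_total x (y x) with h | h
      · rw [min_eq_left h, max_eq_right h]
      · rw [min_eq_right h, max_eq_left h, ← abs_neg]
        congr 1
        ring
    rw [← Finset.mul_sum, ← Finset.mul_sum] at h2
    rw [← Finset.mul_sum]
    have h5 : ε * (10 * ∑ x ∈ s, r x) ≤ ε * κ := by linarith
    exact le_of_mul_le_mul_left h5 hε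
  have hsub : S ⊆ ⋃ x ∈ u, S ∩ G ⁻¹' Metric.closedBall (c x) (5 * r x) := by
    intro x hx
    obtain ⟨b, hb, hxb⟩ := hcov x hx
    refine mem_biUnion hb ⟨hx, hxb ?_⟩
    rw [hball]
    exact left_mem_uIcc
  calc μ S ≤ ∑' x : u, μ (S ∩ G ⁻¹' Metric.closedBall (c x) (5 * r x)) :=
        (measure_mono hsub).trans (measure_biUnion_le μ hcount _)
    _ ≤ ∑' x : u, ENNReal.ofReal (10 * r x) := by
        refine ENNReal.tsum_le_tsum fun x => ?_
        have h := measure_le_of_forall_mem_Icc hG h0 hGa hμ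
          (S := S ∩ G ⁻¹' Metric.closedBall (c x) (5 * r x)) (fun z hz => hz.1.1)
          (fun z hz => Real.closedBall_eq_Icc ▸ hz.2)
        convert h using 2
        ring
    _ ≤ κ := by
        rw [ENNReal.tsum_eq_iSup_sum]
        refine iSup_le fun s => ?_
        rw [← ENNReal.ofReal_sum_of_nonneg fun x _ => by
          have := hrpos x (huS x.2); positivity]
        have h := hfin (s.map (Function.Embedding.subtype _)) (by simp)
        rw [Finset.sum_map] at h
        exact (ENNReal.ofReal_le_ofReal h).trans_eq (ENNReal.ofReal_coe_nnreal)

end Null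

/-! ### Differentiation of the integral -/

section Derivative

variable {K : Type*} [LinearOrder K] [BoundedOrder K] [TopologicalSpace K] [OrderTopology K]
  [CompactSpace K]

/-- At a point where `G` jumps, differentiability holds without exception: the increments of `G`
from the left value are bounded below by the jump. -/
theorem hasGDerivAt_integral_of_leftValue_ne {f G F : K → ℝ} (hG : Monotone G)
    (h0 : ∀ x, 0 ≤ G x) (hF : ∀ x, HasKSIntegral f G ⊥ x (F x)) {x : K} (hr : RegulatedAt G x)
    (hx : leftValue G x ≠ G x) : HasGDerivAt F G x (f x) := by
  refine .inr ⟨hx, regulatedAt_integral hF hr, fun ε hε => ?_⟩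
  have hJ : 0 < G x - leftValue G x := sub_pos.2 ((leftValue_le hG h0 hr).lt_of_ne hx)
  have hev := (Metric.tendsto_nhds.1 (tendsto_integral_sub hF x)) _ (mul_pos hε hJ)
  refine ⟨_, hev, fun y hy => ?_⟩
  have h1 : |F y - F x - f x * (G y - G x) - 0| < ε * (G x - leftValue G x) := hy.1
  rw [sub_zero] at h1
  have h2 := integral_sub_leftValue hF hr
  have h3 : G x ≤ G y := hG hy.2
  have h4 : F y - leftValue F x - f x * (G y - leftValue G x)
      = F y - F x - f x * (G y - G x) := by linear_combination h2
  rw [h4, abs_of_nonneg (by linarith : 0 ≤ G y - leftValue G x)]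
  exact h1.le.trans (mul_le_mul_of_nonneg_left (by linarith) hε.le)

end Derivative

end CompactLine

theorem mainTheorem3 {K : Type*} [LinearOrder K] [BoundedOrder K] [TopologicalSpace K]
    [OrderTopology K] [CompactSpace K] [MeasurableSpace K] [BorelSpace K]
    (f G : K → ℝ) (hG_mono : Monotone G) (hG_nonneg : ∀ x, 0 ≤ G x)
    (hG : CompactLine.Amenable G) (hf : CompactLine.KSIntegrable f G ⊥ ⊤) :
    (∀ x, CompactLine.KSIntegrable f G ⊥ x) ∧
      ∃ Z : Set K, CompactLine.IsGNull G Z ∧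
        ∀ x, x ∉ Z →
          CompactLine.HasGDerivAt (fun y => CompactLine.ksIntegral f G ⊥ y) G x (f x) := by
  have hint : ∀ x, CompactLine.KSIntegrable f G ⊥ x := fun x => hf.initial bot_le le_top
  refine ⟨hint, ?_⟩
  set F : K → ℝ := fun y => CompactLine.ksIntegral f G ⊥ y
  have hF : ∀ x, CompactLine.HasKSIntegral f G ⊥ x (F x) := fun x => (hint x).hasKSIntegral
  obtain ⟨μ, hμ, hdist⟩ := CompactLine.exists_isInducedMeasure hG_mono hG_nonneg hG.1
  have := hμ.1
  -- The first set collects the points at which no derivative is defined; the others are the points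
  -- at which the derivative fails to be `f x` with tolerance `1 / (n + 1)`.
  refine ⟨{x | CompactLine.leftValue G x = G x ∧ ∃ V ∈ 𝓝 x, ∀ y ∈ V, ∀ z ∈ V, G y = G z} ∪
    ⋃ n : ℕ, {x | CompactLine.leftValue G x = G x ∧ ∀ V ∈ 𝓝 x, ∃ y ∈ V,
      1 / ((n : ℝ) + 1) * |G y - G x| < |F y - F x - f x * (G y - G x)|},
    ⟨μ, hμ, CompactLine.outerMeas_eq_zero (measure_union_null
      (CompactLine.measure_setOf_locally_constant hG_mono hG_nonneg hG hdist)
      (measure_iUnion_null fun n => CompactLine.measure_setOf_forall_exists_lt hG_mono hG_nonneg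
        hG hF hdist Nat.one_div_pos_of_nat))⟩, fun x hx => ?_⟩
  by_cases hL : CompactLine.leftValue G x = G x
  · simp only [mem_union, mem_iUnion, mem_ofPred_eq, hL, true_and, not_or, not_exists] at hx
    obtain ⟨h1, h2⟩ := hx
    push Not at h1 h2
    refine .inl ⟨hL, fun _ => ?_, h1, fun ε hε => ?_⟩
    · have := CompactLine.integral_sub_leftValue hF (hG.2 x)
      rw [hL, sub_self, mul_zero] at this
      exact sub_eq_zero.1 this
    · obtain ⟨n, hn⟩ := exists_nat_one_div_lt hε
      obtain ⟨V, hV, h⟩ := h2 n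
      exact ⟨V, hV, fun y hy => (h y hy).trans
        (mul_le_mul_of_nonneg_right hn.le (abs_nonneg _))⟩
  · exact CompactLine.hasGDerivAt_integral_of_leftValue_ne hG_mono hG_nonneg hF (hG.2 x) hL
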